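/- **Theorem 1.** There is a communication protocol between two parties, Alice and Bob, who have private independent random variables but share no randomness (no local hidden variables), and there is a constant $c<22$, such that the following holds. Let $x=(P_0,P_1)$ and $y=(Q_0,Q_1)$ be any von Neumann measurements on a qubit, that is, pairs of mutually orthogonal orthogonal projections on $\mathbb{C}^2$ with $P_0+P_1=I=Q_0+Q_1$. If Alice is given only $x$ and Bob is given only $y$, then Alice and Bob output $a,b\in\{0,1\}$ with joint distribution exactly that of measuring the two qubits of the Bell state $|\Psi\rangle=\frac{1}{\sqrt2}(|00\rangle+|11\rangle)$ according to $x$ and $y$: $$\Pr[(a,b)]=\langle\Psi|\,P_a\otimes Q_b\,|\Psi\rangle\qquad (a,b\in\{0,1\}),$$ and the expected total number of bits sent in both directions is at most $c$. In the protocol, bits are sent one at a time; who sends the next bit and whether the protocol has ended is determined by the bits sent so far; each bit a party sends and its output depend only on its own input, its own private random variable and the bits sent so far. -/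

import Mathlib

open MeasureTheory
open scoped ENNReal Kronecker

noncomputable section

/-- A von Neumann (projective) measurement with outcomes in `O` on the system `ℂ^ι`: a family of
mutually orthogonal orthogonal projections that sum to the identity. Degenerate measurements, where
some projections vanish or have rank above one, are included. -/
structure VonNeumannMeasurement (O ι : Type) [Fintype O] [Fintype ι] [DecidableEq ι] where
  proj : O → Matrix ι ι ℂ
  isStarProjection : ∀ o, IsStarProjection (proj o)
  orthogonal : ∀ o o', o ≠ o' → proj o * proj o' = 0
  sum_eq_one : ∑ o, proj o = 1

/-- The von Neumann measurements on a qubit, with outcomes labelled by `Fin 2`. -/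
abbrev QubitMeasurement : Type := VonNeumannMeasurement (Fin 2) (Fin 2)

/-- The vector `(|00⟩ + |11⟩) / √2`, by its coordinates in the basis `|ij⟩`. -/
def bellState : Fin 2 × Fin 2 → ℂ :=
  ((Real.sqrt 2 : ℝ) : ℂ)⁻¹ • (Pi.single (0, 0) 1 + Pi.single (1, 1) 1)

/-- The Born rule: the probability `⟨ψ| A_a ⊗ B_b |ψ⟩` that the outcomes are `a` and `b` if the
two parts of `ψ` are measured according to `A` and `B`. -/
def bornProb {O O' ι κ : Type} [Fintype O] [Fintype O'] [Fintype ι] [Fintype κ]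
    [DecidableEq ι] [DecidableEq κ] (ψ : ι × κ → ℂ)
    (A : VonNeumannMeasurement O ι) (B : VonNeumannMeasurement O' κ) (a : O) (b : O') : ℝ :=
  (star ψ ⬝ᵥ ((A.proj a ⊗ₖ B.proj b).mulVec ψ)).re

/-- What happens next in a protocol: one of the parties sends a bit, or the protocol ends. -/
inductive Turn where
  | alice
  | bob
  | done

/-- A two-party interactive communication protocol with private randomness, for inputs in `X`
(Alice) and `Y` (Bob) and outputs in `A` and `B`. The public transcript (the list of bits sent so
far, in order) alone determines whose turn it is and whether the protocol is over. Each party has a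
private random variable, whose law may depend only on that party's own input. The bits that a party
sends and its output depend only on its own input, its own private random variable and the
transcript. -/
structure Protocol (X Y A B : Type) where
  turn : List Bool → Turn
  ΩA : Type
  ΩB : Type
  [measA : MeasurableSpace ΩA]
  [measB : MeasurableSpace ΩB]
  lawA : X → Measure ΩA
  lawB : Y → Measure ΩB
  probA : ∀ x, IsProbabilityMeasure (lawA x)
  probB : ∀ y, IsProbabilityMeasure (lawB y)
  msgA : X → List Bool → ΩA → Bool
  msgB : Y → List Bool → ΩB → Bool
  outA : X → List Bool → ΩA → A
  outB : Y → List Bool → ΩB → B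
  measurable_msgA : ∀ x t, Measurable (msgA x t)
  measurable_msgB : ∀ y t, Measurable (msgB y t)
  measurable_outA : ∀ x t, Measurable[_, ⊤] (outA x t)
  measurable_outB : ∀ y t, Measurable[_, ⊤] (outB y t)

namespace Protocol

attribute [instance] Protocol.measA Protocol.measB

variable {X Y A B : Type}

/-- One step of the protocol: the transcript `t` is extended by the next bit, if there is one. -/
def step (P : Protocol X Y A B) (x : X) (y : Y) (ω : P.ΩA × P.ΩB) (t : List Bool) : List Bool :=
  match P.turn t with
  | Turn.alice => t ++ [P.msgA x t ω.1]
  | Turn.bob => t ++ [P.msgB y t ω.2]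
  | Turn.done => t

/-- The transcript after at most `n` bits. -/
def transcript (P : Protocol X Y A B) (x : X) (y : Y) (ω : P.ΩA × P.ΩB) (n : ℕ) : List Bool :=
  (P.step x y ω)^[n] []

/-- The total number of bits sent by both parties, infinite if the protocol does not end. -/
def cost (P : Protocol X Y A B) (x : X) (y : Y) (ω : P.ΩA × P.ΩB) : ℝ≥0∞ :=
  ⨆ n, ((P.transcript x y ω n).length : ℝ≥0∞)

/-- The joint law of the private random variables: they are independent, so the parties share no
randomness. -/
def law (P : Protocol X Y A B) (x : X) (y : Y) : Measure (P.ΩA × P.ΩB) :=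
  (P.lawA x).prod (P.lawB y)

/-- The expected total number of bits sent by both parties on inputs `x` and `y`. -/
def expectedCost (P : Protocol X Y A B) (x : X) (y : Y) : ℝ≥0∞ :=
  ∫⁻ ω, P.cost x y ω ∂(P.law x y)

/-- The probability that on inputs `x` and `y` the protocol ends, Alice outputs `a` and Bob outputs
`b`. -/
def outputProb (P : Protocol X Y A B) (x : X) (y : Y) (a : A) (b : B) : ℝ :=
  (P.law x y).real {ω | ∃ n, P.turn (P.transcript x y ω n) = Turn.done ∧
    P.outA x (P.transcript x y ω n) ω.1 = a ∧ P.outB y (P.transcript x y ω n) ω.2 = b}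

end Protocol

end

-- On the Bell state, `⟨Ψ|P ⊗ Q|Ψ⟩ = tr(P Qᵀ)/2`. So Alice can draw her outcome `a` with probability
-- `tr(P_a)/2` without communication, after which Bob must output `0` with probability `p = condProb
-- x y a`. This `p` is affine in the Bloch coordinates of `P_a / tr P_a`, known to Alice, with
-- coefficients known to Bob. He draws a uniform `r` and has to decide whether `r < p`, for which
-- approximations of `p` usually suffice.
--
-- Alice sends three coordinates by bisection, one bit of each per round, and Bob answers whether he
-- can decide. After `k` rounds each coordinate is known up to `2⁻ᵏ`, hence `p` up to `3/2 · 2⁻ᵏ`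
-- (`abs_effectProb_sub_le`). If Bob is still undecided, then `|r - p| ≤ 3 · 2⁻ᵏ`, an event of
-- probability at most `6 · 2⁻ᵏ`. Any decision made is correct, and only the null event `r = p`
-- prevents one, so the simulation is exact. A round costs four bits, so the expected cost is at
-- most `4 ∑ₖ min(1, 6 · 2⁻ᵏ) = 4 (3 + 3/2) = 18`.

open Finset in
/-- The centre of the interval of the `i`-th coordinate after the bits `t`. The bit at position `j`
halves the interval of the coordinate `j % 4`, where the positions that are `3` modulo `4` are Bob's
and belong to no coordinate. -/
noncomputable def centre (t : List Bool) (i : ℕ) : ℝ :=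
  ∑ j ∈ range t.length,
    if j % 4 = i then (if t.getD j false then 1 else -1) * (1 / 2 : ℝ) ^ (j / 4 + 1) else 0

theorem centre_append (t : List Bool) (b : Bool) (i : ℕ) :
    centre (t ++ [b]) i = centre t i +
      if t.length % 4 = i then (if b then 1 else -1) * (1 / 2 : ℝ) ^ (t.length / 4 + 1) else 0 := by
  unfold centre
  rw [List.length_append, List.length_singleton, Finset.sum_range_succ]
  congr 1
  · refine Finset.sum_congr rfl fun j hj => ?_
    rw [List.getD_append _ _ _ _ (Finset.mem_range.1 hj)]
  · simp

-- Bloch coordinates and bounds for qubit projections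

/-- The Bloch coordinates of `M / tr M`. -/
noncomputable def blochCoord (M : Matrix (Fin 2) (Fin 2) ℂ) : ℕ → ℝ
  | 0 => ((M 0 0).re - (M 1 1).re) / ((M 0 0).re + (M 1 1).re)
  | 1 => 2 * (M 0 1).re / ((M 0 0).re + (M 1 1).re)
  | _ => 2 * (M 0 1).im / ((M 0 0).re + (M 1 1).re)

/-- The coefficients of the Bloch coordinates of a state in the probability of the transposed
effect `N`. -/
noncomputable def effectCoord (N : Matrix (Fin 2) (Fin 2) ℂ) : ℕ → ℝ
  | 0 => ((N 0 0).re - (N 1 1).re) / 2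
  | 1 => (N 0 1).re
  | _ => -(N 0 1).im

/-- The probability of the transposed effect `N` in the state with Bloch coordinates `u`. -/
noncomputable def effectProb (N : Matrix (Fin 2) (Fin 2) ℂ) (u : ℕ → ℝ) : ℝ :=
  ((N 0 0).re + (N 1 1).re) / 2 + ∑ i ∈ Finset.range 3, u i * effectCoord N i

theorem effectProb_congr_of_lt {N : Matrix (Fin 2) (Fin 2) ℂ} {u u' : ℕ → ℝ}
    (h : ∀ i < 3, u i = u' i) : effectProb N u = effectProb N u' := by
  unfold effectProb
  congr 1
  exact Finset.sum_congr rfl fun i hi => by rw [h i (Finset.mem_range.1 hi)]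

theorem effectProb_blochCoord (M N : Matrix (Fin 2) (Fin 2) ℂ) :
    effectProb N (blochCoord M) = ((N 0 0).re + (N 1 1).re) / 2 +
      (((M 0 0).re - (M 1 1).re) * ((N 0 0).re - (N 1 1).re) / 2 +
        2 * (M 0 1).re * (N 0 1).re - 2 * (M 0 1).im * (N 0 1).im) /
        ((M 0 0).re + (M 1 1).re) := by
  simp only [effectProb, Finset.sum_range_succ, Finset.sum_range_zero, blochCoord, effectCoord]
  ring

/-- The entries of an orthogonal projection on `ℂ²`. -/
theorem entries_of_isStarProjection {M : Matrix (Fin 2) (Fin 2) ℂ} (h : IsStarProjection M) :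
    (M 0 0).im = 0 ∧ (M 1 1).im = 0 ∧ M 1 0 = star (M 0 1) ∧
      0 ≤ (M 0 0).re ∧ 0 ≤ (M 1 1).re ∧ (M 0 0).re ≤ 1 ∧ (M 1 1).re ≤ 1 ∧
      (M 0 1).re ^ 2 + (M 0 1).im ^ 2 ≤ 1 / 4 ∧
      (M 0 1).re ^ 2 + (M 0 1).im ^ 2 ≤ (M 0 0).re * (M 1 1).re := by
  have hs : M.conjTranspose = M := h.isSelfAdjoint
  have hm : M * M = M := h.isIdempotentElem
  have e (i j) : star (M j i) = M i j := by
    rw [← Matrix.conjTranspose_apply, hs]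
  have f (i j) : M i 0 * M 0 j + M i 1 * M 1 j = M i j := by
    conv_rhs => rw [← hm, Matrix.mul_apply, Fin.sum_univ_two]
  have e00 := congrArg Complex.im (e 0 0)
  have e11 := congrArg Complex.im (e 1 1)
  have e10 := (e 1 0).symm
  have f00 := congrArg Complex.re (f 0 0)
  have f11 := congrArg Complex.re (f 1 1)
  have f01r := congrArg Complex.re (f 0 1)
  have f01i := congrArg Complex.im (f 0 1)
  simp only [Complex.star_def, Complex.conj_im, Complex.conj_re, e10, Complex.add_re,
    Complex.add_im, Complex.mul_re, Complex.mul_im] at e00 e11 f00 f11 f01r f01i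
  have i0 : (M 0 0).im = 0 := by linarith
  have i1 : (M 1 1).im = 0 := by linarith
  simp only [i0, i1] at f00 f11 f01r f01i
  have p0 : 0 ≤ (M 0 0).re := by nlinarith [sq_nonneg (M 0 1).re, sq_nonneg (M 0 1).im]
  have p1 : 0 ≤ (M 1 1).re := by nlinarith [sq_nonneg (M 0 1).re, sq_nonneg (M 0 1).im]
  refine ⟨i0, i1, e10, p0, p1, ?_, ?_, ?_, ?_⟩
  · nlinarith [sq_nonneg (M 0 1).re, sq_nonneg (M 0 1).im]
  · nlinarith [sq_nonneg (M 0 1).re, sq_nonneg (M 0 1).im]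
  · nlinarith [sq_nonneg ((M 0 0).re - 1 / 2)]
  -- The off-diagonal entry of `M² = M` gives `(tr M - 1) M₀₁ = 0`, so either the trace is `1` or
  -- `M` is diagonal.
  · by_cases ht : (M 0 0).re + (M 1 1).re = 1
    · have : (M 1 1).re = 1 - (M 0 0).re := by linarith
      rw [this]
      nlinarith
    · have hr : (M 0 1).re = 0 := by
        refine (mul_eq_zero.1 (?_ : ((M 0 0).re + (M 1 1).re - 1) * (M 0 1).re = 0)).resolve_left
          (sub_ne_zero.2 ht)
        linarith
      have hi : (M 0 1).im = 0 := by
        refine (mul_eq_zero.1 (?_ : ((M 0 0).re + (M 1 1).re - 1) * (M 0 1).im = 0)).resolve_left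
          (sub_ne_zero.2 ht)
        linarith
      rw [hr, hi]
      nlinarith

theorem abs_blochCoord_le {M : Matrix (Fin 2) (Fin 2) ℂ} (h : IsStarProjection M) (i : ℕ) :
    |blochCoord M i| ≤ 1 := by
  obtain ⟨-, -, -, p0, p1, -, -, -, hd⟩ := entries_of_isStarProjection h
  have aux (z : ℝ) (hz : z ^ 2 ≤ ((M 0 0).re + (M 1 1).re) ^ 2) :
      |z / ((M 0 0).re + (M 1 1).re)| ≤ 1 := by
    have ht : 0 ≤ (M 0 0).re + (M 1 1).re := by positivity
    rw [abs_div, abs_of_nonneg ht]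
    exact div_le_one_of_le₀ (abs_le_of_sq_le_sq hz ht) ht
  match i with
  | 0 => exact aux _ (by nlinarith [mul_nonneg p0 p1])
  | 1 => exact aux _ (by
      nlinarith [sq_nonneg (M 0 1).im, sq_nonneg ((M 0 0).re - (M 1 1).re)])
  | _ + 2 => exact aux _ (by
      nlinarith [sq_nonneg (M 0 1).re, sq_nonneg ((M 0 0).re - (M 1 1).re)])

theorem abs_effectCoord_le {N : Matrix (Fin 2) (Fin 2) ℂ} (h : IsStarProjection N) (i : ℕ) :
    |effectCoord N i| ≤ 1 / 2 := by
  obtain ⟨-, -, -, p0, p1, q0, q1, hd, -⟩ := entries_of_isStarProjection h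
  match i with
  | 0 => exact abs_le.2 ⟨by simp only [effectCoord]; linarith, by simp only [effectCoord]; linarith⟩
  | 1 =>
    refine abs_le_of_sq_le_sq ?_ (by norm_num)
    simp only [effectCoord]
    nlinarith [sq_nonneg (N 0 1).im]
  | _ + 2 =>
    refine abs_le_of_sq_le_sq ?_ (by norm_num)
    simp only [effectCoord]
    nlinarith [sq_nonneg (N 0 1).re]

/-- Positivity of `tr(M Nᵀ)`: the off-diagonal part is controlled by `|M₀₁|² ≤ M₀₀ M₁₁`, the same
for `N`, and AM-GM on the diagonal products. -/
theorem overlap_nonneg {M N : Matrix (Fin 2) (Fin 2) ℂ} (hM : IsStarProjection M)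
    (hN : IsStarProjection N) :
    0 ≤ (M 0 0).re * (N 0 0).re + (M 1 1).re * (N 1 1).re +
      2 * ((M 0 1).re * (N 0 1).re - (M 0 1).im * (N 0 1).im) := by
  obtain ⟨-, -, -, p0, p1, -, -, -, hp⟩ := entries_of_isStarProjection hM
  obtain ⟨-, -, -, q0, q1, -, -, -, hq⟩ := entries_of_isStarProjection hN
  have h1 : (2 * ((M 0 1).re * (N 0 1).re - (M 0 1).im * (N 0 1).im)) ^ 2 ≤
      ((M 0 0).re * (N 0 0).re + (M 1 1).re * (N 1 1).re) ^ 2 := by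
    have h2 := mul_le_mul hp hq (by positivity) (by positivity)
    nlinarith [sq_nonneg ((M 0 1).re * (N 0 1).im + (M 0 1).im * (N 0 1).re),
      sq_nonneg ((M 0 0).re * (N 0 0).re - (M 1 1).re * (N 1 1).re)]
  have := neg_le_of_abs_le (abs_le_of_sq_le_sq h1 (by positivity))
  linarith

/-- Three coordinates, each with a coefficient of size at most `1/2`. This `3/2` is the constant in
`radius`. -/
theorem abs_effectProb_sub_le {N : Matrix (Fin 2) (Fin 2) ℂ} (h : IsStarProjection N)
    {u u' : ℕ → ℝ} {ε : ℝ} (hε : ∀ i < 3, |u i - u' i| ≤ ε) :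
    |effectProb N u - effectProb N u'| ≤ 3 / 2 * ε := by
  have : effectProb N u - effectProb N u' =
      ∑ i ∈ Finset.range 3, (u i - u' i) * effectCoord N i := by
    simp only [effectProb, add_sub_add_left_eq_sub, ← Finset.sum_sub_distrib, sub_mul]
  rw [this]
  have hb : ∀ i ∈ Finset.range 3, |(u i - u' i) * effectCoord N i| ≤ ε * (1 / 2) := by
    intro i hi
    rw [abs_mul]
    have h1 := hε i (Finset.mem_range.1 hi)
    exact mul_le_mul h1 (abs_effectCoord_le h i) (abs_nonneg _) ((abs_nonneg _).trans h1)
  refine (Finset.abs_sum_le_sum_abs _ _).trans ((Finset.sum_le_sum hb).trans ?_)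
  simp only [Finset.sum_const, Finset.card_range, nsmul_eq_mul]
  norm_num
  linarith

-- The Born rule on the Bell state as Alice's marginal times Bob's conditional

namespace QubitMeasurement

theorem apply_one (x : QubitMeasurement) (i j : Fin 2) :
    x.proj 1 i j = (1 : Matrix (Fin 2) (Fin 2) ℂ) i j - x.proj 0 i j := by
  have := congrFun (congrFun x.sum_eq_one i) j
  rw [Fin.sum_univ_two, Matrix.add_apply] at this
  rw [← this]
  ring

/-- The probability of outcome `a` for a maximally mixed qubit. -/
noncomputable def weight (x : QubitMeasurement) (a : Fin 2) : ℝ :=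
  ((x.proj a 0 0).re + (x.proj a 1 1).re) / 2

theorem weight_nonneg (x : QubitMeasurement) (a : Fin 2) : 0 ≤ x.weight a := by
  obtain ⟨-, -, -, p0, p1, -⟩ := entries_of_isStarProjection (x.isStarProjection a)
  unfold weight
  positivity

theorem weight_add (x : QubitMeasurement) : x.weight 0 + x.weight 1 = 1 := by
  simp only [weight, apply_one, Matrix.one_apply_eq, Complex.sub_re, Complex.one_re]
  ring

/-- The probability that Bob's outcome is `0` if Alice's is `a`. -/
noncomputable def condProb (x y : QubitMeasurement) (a : Fin 2) : ℝ :=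
  effectProb (y.proj 0) (blochCoord (x.proj a))

/-- Multiplying by the weight clears the trace from the denominator. For trace zero the whole
projection vanishes, so the default value of division by zero is harmless. -/
theorem weight_mul_condProb (x y : QubitMeasurement) (a : Fin 2) :
    2 * (x.weight a * condProb x y a) =
      (x.proj a 0 0).re * (y.proj 0 0 0).re + (x.proj a 1 1).re * (y.proj 0 1 1).re +
      2 * ((x.proj a 0 1).re * (y.proj 0 0 1).re - (x.proj a 0 1).im * (y.proj 0 0 1).im) := by
  obtain ⟨-, -, -, p0, p1, -, -, -, hd⟩ := entries_of_isStarProjection (x.isStarProjection a)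
  rw [condProb, effectProb_blochCoord, weight]
  by_cases ht : (x.proj a 0 0).re + (x.proj a 1 1).re = 0
  · have h0 : (x.proj a 0 0).re = 0 := by linarith
    have h1 : (x.proj a 1 1).re = 0 := by linarith
    rw [h0, h1] at hd ⊢
    have hr : (x.proj a 0 1).re = 0 := by nlinarith [sq_nonneg (x.proj a 0 1).im]
    have hi : (x.proj a 0 1).im = 0 := by nlinarith [sq_nonneg (x.proj a 0 1).re]
    rw [hr, hi]
    ring
  · field_simp
    ring

theorem condProb_mem (x y : QubitMeasurement) (a : Fin 2) (h : x.weight a ≠ 0) :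
    0 ≤ condProb x y a ∧ condProb x y a ≤ 1 := by
  have hw := lt_of_le_of_ne (x.weight_nonneg a) h.symm
  have e := weight_mul_condProb x y a
  have h0 := overlap_nonneg (x.isStarProjection a) (y.isStarProjection 0)
  -- Positivity for the complementary effect gives the upper bound.
  have h1 := overlap_nonneg (x.isStarProjection a) (y.isStarProjection 1)
  simp only [apply_one y, Matrix.one_apply_eq, Complex.sub_re, Complex.one_re,
    Matrix.one_apply_ne (zero_ne_one : (0 : Fin 2) ≠ 1), Complex.sub_im, Complex.zero_re,
    Complex.zero_im] at h1
  have hw' : 2 * x.weight a = (x.proj a 0 0).re + (x.proj a 1 1).re := by unfold weight; ring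
  constructor
  · refine le_of_mul_le_mul_left (a := x.weight a) ?_ hw
    linarith
  · refine le_of_mul_le_mul_left (a := x.weight a) ?_ hw
    linarith

theorem bornProb_bellState (x y : QubitMeasurement) (a b : Fin 2) :
    2 * bornProb bellState x y a b =
      (x.proj a 0 0).re * (y.proj b 0 0).re + (x.proj a 1 1).re * (y.proj b 1 1).re +
      2 * ((x.proj a 0 1).re * (y.proj b 0 1).re - (x.proj a 0 1).im * (y.proj b 0 1).im) := by
  obtain ⟨i0, i1, i2, -⟩ := entries_of_isStarProjection (x.isStarProjection a)
  obtain ⟨j0, j1, j2, -⟩ := entries_of_isStarProjection (y.isStarProjection b)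
  have hψ (i j : Fin 2) : bellState (i, j) = if i = j then ((Real.sqrt 2 : ℝ) : ℂ)⁻¹ else 0 := by
    fin_cases i <;> fin_cases j <;> simp [bellState]
  have hs : ((Real.sqrt 2 : ℝ) : ℂ)⁻¹ * ((Real.sqrt 2 : ℝ) : ℂ)⁻¹ = ((1 / 2 : ℝ) : ℂ) := by
    rw [← mul_inv, ← Complex.ofReal_mul, Real.mul_self_sqrt (by norm_num)]
    simp
  have hc : star (((Real.sqrt 2 : ℝ) : ℂ)⁻¹) = ((Real.sqrt 2 : ℝ) : ℂ)⁻¹ := by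
    simp
  have key : star bellState ⬝ᵥ ((x.proj a ⊗ₖ y.proj b).mulVec bellState) =
      ((1 / 2 : ℝ) : ℂ) * (x.proj a 0 0 * y.proj b 0 0 + x.proj a 0 1 * y.proj b 0 1 +
        x.proj a 1 0 * y.proj b 1 0 + x.proj a 1 1 * y.proj b 1 1) := by
    simp only [dotProduct, Matrix.mulVec, Fintype.sum_prod_type, Fin.sum_univ_two, Pi.star_apply,
      hψ, Matrix.kroneckerMap_apply, zero_ne_one, one_ne_zero, if_true, if_false, star_zero, hc,
      mul_zero, zero_mul, add_zero, zero_add, ← hs]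
    ring
  rw [bornProb, key, Complex.re_ofReal_mul, i2, j2]
  simp only [Complex.add_re, Complex.mul_re, Complex.star_def, Complex.conj_re, Complex.conj_im,
    i0, i1, j0, j1]
  ring

theorem bornProb_zero (x y : QubitMeasurement) (a : Fin 2) :
    bornProb bellState x y a 0 = x.weight a * condProb x y a := by
  linarith [bornProb_bellState x y a 0, weight_mul_condProb x y a]

theorem bornProb_one (x y : QubitMeasurement) (a : Fin 2) :
    bornProb bellState x y a 1 = x.weight a * (1 - condProb x y a) := by
  have h1 := bornProb_bellState x y a 1
  simp only [apply_one y, Matrix.one_apply_eq, Complex.sub_re, Complex.one_re,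
    Matrix.one_apply_ne (zero_ne_one : (0 : Fin 2) ≠ 1), Complex.sub_im, Complex.zero_re,
    Complex.zero_im] at h1
  have hw' : 2 * x.weight a = (x.proj a 0 0).re + (x.proj a 1 1).re := by unfold weight; ring
  linarith [weight_mul_condProb x y a]

/-- The law of Alice's outcome. -/
noncomputable def outcomeLaw (x : QubitMeasurement) : Measure (Fin 2) :=
  ∑ a, ENNReal.ofReal (x.weight a) • Measure.dirac a

theorem outcomeLaw_singleton (x : QubitMeasurement) (a : Fin 2) :
    x.outcomeLaw {a} = ENNReal.ofReal (x.weight a) := by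
  fin_cases a <;> simp [outcomeLaw, Fin.sum_univ_two]

instance (x : QubitMeasurement) : IsProbabilityMeasure x.outcomeLaw where
  measure_univ := by
    simp only [outcomeLaw, Fin.sum_univ_two, Measure.add_apply, Measure.smul_apply, measure_univ,
      smul_eq_mul, mul_one]
    rw [← ENNReal.ofReal_add (x.weight_nonneg 0) (x.weight_nonneg 1), x.weight_add,
      ENNReal.ofReal_one]

end QubitMeasurement

-- The protocol

/-- The transcripts at which the protocol is over: complete rounds of three bits of Alice and one
bit of Bob, where the last bit says that Bob needs no further information. -/
def Ended (t : List Bool) : Prop := t.length % 4 = 0 ∧ t.getLast? = some true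

/-- Bob's tolerance at the end of a round. -/
noncomputable def radius (t : List Bool) : ℝ := 3 / 2 * (1 / 2) ^ ((t.length + 1) / 4)

/-- The uniform law on the unit interval. -/
noncomputable def unitLaw : Measure ℝ := volume.restrict (Set.Icc 0 1)

instance : IsProbabilityMeasure unitLaw where
  measure_univ := by simp [unitLaw]

open Classical in
/-- Alice draws her outcome and sends the Bloch coordinates of the state to which it steers Bob's
qubit, bit by bit in parallel. Bob draws a uniform number and, after each round, says whether its
comparison with his conditional probability is settled. -/
noncomputable def bellProtocol :
    Protocol QubitMeasurement QubitMeasurement (Fin 2) (Fin 2) where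
  turn t := if Ended t then Turn.done else if t.length % 4 = 3 then Turn.bob else Turn.alice
  ΩA := Fin 2
  ΩB := ℝ
  lawA x := x.outcomeLaw
  lawB _ := unitLaw
  probA _ := inferInstance
  probB _ := inferInstance
  msgA x t a := decide (centre t (t.length % 4) ≤ blochCoord (x.proj a) (t.length % 4))
  msgB y t r := decide (radius t < |r - effectProb (y.proj 0) (centre t)|)
  outA _ _ a := a
  outB y t r := if r < effectProb (y.proj 0) (centre t) then 0 else 1
  measurable_msgA _ _ := Measurable.of_discrete
  measurable_msgB y t := by
    refine measurable_to_bool ?_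
    have : (fun r : ℝ => decide (radius t < |r - effectProb (y.proj 0) (centre t)|)) ⁻¹' {true} =
        {r | radius t < |r - effectProb (y.proj 0) (centre t)|} := by
      ext r
      simp
    rw [this]
    exact measurableSet_lt (by fun_prop) (by fun_prop)
  measurable_outA _ _ := Measurable.of_discrete
  measurable_outB y t :=
    Measurable.ite (measurableSet_lt (by fun_prop) (by fun_prop)) measurable_const measurable_const

-- Invariants of the transcript

open QubitMeasurement

/-- What holds for every transcript `t` that the protocol reaches on the inputs `x`, `y` with
private random variables `a`, `r`. -/
structure Reachable (x y : QubitMeasurement) (a : Fin 2) (r : ℝ) (t : List Bool) : Prop where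
  -- The exponent counts the positions `j < t.length` with `j % 4 = i`, that is, the bisections of
  -- coordinate `i` so far.
  abs_sub_centre_le : ∀ i < 3,
    |blochCoord (x.proj a) i - centre t i| ≤ (1 / 2 : ℝ) ^ ((t.length + 3 - i) / 4)
  of_not_ended : ¬ Ended t → 4 ≤ t.length → |r - condProb x y a| ≤ 3 * (1 / 2) ^ (t.length / 4)
  of_ended : Ended t → (r < effectProb (y.proj 0) (centre t) → r < condProb x y a) ∧
    (¬ r < effectProb (y.proj 0) (centre t) → condProb x y a < r)

theorem reachable_nil (x y : QubitMeasurement) (a : Fin 2) (r : ℝ) : Reachable x y a r [] where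
  abs_sub_centre_le i hi := by
    have h4 : (3 - i) / 4 = 0 := by omega
    simpa [centre, h4] using abs_blochCoord_le (x.isStarProjection a) i
  of_not_ended := by simp
  of_ended := by simp [Ended]

theorem ended_append (t : List Bool) (b : Bool) :
    Ended (t ++ [b]) ↔ t.length % 4 = 3 ∧ b = true := by
  simp only [Ended, List.length_append, List.length_singleton, List.getLast?_append,
    List.getLast?_singleton, Option.some_or, Option.some.injEq]
  exact and_congr_left fun _ => by omega

theorem bellProtocol_step_of_ended {x y : QubitMeasurement} {ω : Fin 2 × ℝ} {t : List Bool}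
    (h : Ended t) : bellProtocol.step x y ω t = t := by
  simp [Protocol.step, bellProtocol, h]

theorem bellProtocol_step_bob {x y : QubitMeasurement} {ω : Fin 2 × ℝ} {t : List Bool}
    (h : ¬ Ended t) (h3 : t.length % 4 = 3) :
    bellProtocol.step x y ω t = t ++ [bellProtocol.msgB y t ω.2] := by
  simp [Protocol.step, bellProtocol, h, h3]

theorem bellProtocol_step_alice {x y : QubitMeasurement} {ω : Fin 2 × ℝ} {t : List Bool}
    (h : ¬ Ended t) (h3 : t.length % 4 ≠ 3) :
    bellProtocol.step x y ω t = t ++ [bellProtocol.msgA x t ω.1] := by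
  simp [Protocol.step, bellProtocol, h, h3]

theorem length_bellProtocol_step {x y : QubitMeasurement} {ω : Fin 2 × ℝ} {t : List Bool}
    (h : ¬ Ended t) : (bellProtocol.step x y ω t).length = t.length + 1 := by
  by_cases h3 : t.length % 4 = 3
  · rw [bellProtocol_step_bob h h3]; simp
  · rw [bellProtocol_step_alice h h3]; simp

theorem bellProtocol_turn_eq_done {t : List Bool} : bellProtocol.turn t = Turn.done ↔ Ended t := by
  simp only [bellProtocol]
  split_ifs <;> simp_all

open Classical in
theorem bellProtocol_outB (y : QubitMeasurement) (t : List Bool) (r : ℝ) :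
    bellProtocol.outB y t r = if r < effectProb (y.proj 0) (centre t) then 0 else 1 := rfl

/-- Halving an interval at its centre. -/
theorem abs_sub_bisect_le {u c ε : ℝ} (h : |u - c| ≤ 2 * ε) :
    |u - (c + (if decide (c ≤ u) then 1 else -1) * ε)| ≤ ε := by
  rw [abs_le] at h
  by_cases hc : c ≤ u
  · simp only [hc, decide_true, if_true]
    exact abs_le.2 ⟨by linarith, by linarith⟩
  · simp only [hc, decide_false, if_false, Bool.false_eq_true]
    exact abs_le.2 ⟨by linarith, by linarith⟩

theorem Reachable.alice {x y : QubitMeasurement} {a : Fin 2} {r : ℝ} {t : List Bool}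
    (h : Reachable x y a r t) (ht : ¬ Ended t) (h3 : t.length % 4 ≠ 3) :
    Reachable x y a r (t ++ [bellProtocol.msgA x t a]) where
  abs_sub_centre_le i hi := by
    have hb := h.abs_sub_centre_le i hi
    rw [centre_append, List.length_append, List.length_singleton]
    by_cases hi' : t.length % 4 = i
    · have e1 : (t.length + 3 - i) / 4 = t.length / 4 := by omega
      have e2 : (t.length + 1 + 3 - i) / 4 = t.length / 4 + 1 := by omega
      rw [e1] at hb
      rw [if_pos hi', e2]
      have := abs_sub_bisect_le (ε := (1 / 2 : ℝ) ^ (t.length / 4 + 1))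
        (hb.trans_eq (by rw [pow_succ]; ring))
      subst hi'
      simpa [bellProtocol] using this
    · have e : (t.length + 1 + 3 - i) / 4 = (t.length + 3 - i) / 4 := by omega
      rw [if_neg hi', e, add_zero]
      exact hb
  of_not_ended _ hl := by
    have e : (t ++ [bellProtocol.msgA x t a]).length / 4 = t.length / 4 := by
      simp only [List.length_append, List.length_singleton] at hl ⊢
      omega
    rw [e]
    refine h.of_not_ended ht ?_
    simp only [List.length_append, List.length_singleton] at hl
    omega
  of_ended he := absurd ((ended_append _ _).1 he).1 h3

/-- Both claims compare `r` and `condProb` through Bob's estimate, which is within `radius t` of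
`condProb`: if `r` is farther away, it lies on the same side of both; otherwise the two are within
`2 * radius t`. -/
theorem Reachable.bob {x y : QubitMeasurement} {a : Fin 2} {r : ℝ} {t : List Bool}
    (h : Reachable x y a r t) (h3 : t.length % 4 = 3) :
    Reachable x y a r (t ++ [bellProtocol.msgB y t r]) := by
  have hc (i) (hi : i < 3) : centre (t ++ [bellProtocol.msgB y t r]) i = centre t i := by
    rw [centre_append, if_neg (by omega), add_zero]
  have hp : effectProb (y.proj 0) (centre (t ++ [bellProtocol.msgB y t r])) =
      effectProb (y.proj 0) (centre t) := effectProb_congr_of_lt hc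
  have herr : |condProb x y a - effectProb (y.proj 0) (centre t)| ≤ radius t := by
    refine abs_effectProb_sub_le (y.isStarProjection 0) fun i hi => ?_
    have e : (t.length + 1) / 4 = (t.length + 3 - i) / 4 := by omega
    rw [e]
    exact h.abs_sub_centre_le i hi
  have hmsg : bellProtocol.msgB y t r = true ↔
      radius t < |r - effectProb (y.proj 0) (centre t)| := by
    simp [bellProtocol]
  have herr' := abs_le.1 herr
  refine ⟨fun i hi => ?_, fun he _ => ?_, fun he => ?_⟩
  · rw [hc i hi, List.length_append, List.length_singleton]
    have e : (t.length + 1 + 3 - i) / 4 = (t.length + 3 - i) / 4 := by omega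
    rw [e]
    exact h.abs_sub_centre_le i hi
  · rw [ended_append, hmsg, not_and, not_lt] at he
    have hr := abs_le.1 (he h3)
    have hrad : radius t + radius t =
        3 * (1 / 2) ^ ((t ++ [bellProtocol.msgB y t r]).length / 4) := by
      simp only [radius, List.length_append, List.length_singleton]
      ring
    rw [← hrad]
    exact abs_le.2 ⟨by linarith, by linarith⟩
  · rw [ended_append, hmsg, lt_abs] at he
    rw [hp]
    have hrad : 0 ≤ radius t := by unfold radius; positivity
    constructor
    · intro hlt
      rcases he.2 with h' | h' <;> linarith
    · intro hge
      rw [not_lt] at hge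
      rcases he.2 with h' | h' <;> linarith

theorem bellProtocol_transcript_succ (x y : QubitMeasurement) (ω : Fin 2 × ℝ) (n : ℕ) :
    bellProtocol.transcript x y ω (n + 1) =
      bellProtocol.step x y ω (bellProtocol.transcript x y ω n) :=
  Function.iterate_succ_apply' _ _ _

theorem reachable_transcript (x y : QubitMeasurement) (ω : Fin 2 × ℝ) (n : ℕ) :
    Reachable x y ω.1 ω.2 (bellProtocol.transcript x y ω n) := by
  induction n with
  | zero => exact reachable_nil x y ω.1 ω.2
  | succ n ih =>
    rw [bellProtocol_transcript_succ]
    by_cases he : Ended (bellProtocol.transcript x y ω n)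
    · rwa [bellProtocol_step_of_ended he]
    · by_cases h3 : (bellProtocol.transcript x y ω n).length % 4 = 3
      · rw [bellProtocol_step_bob he h3]
        exact ih.bob h3
      · rw [bellProtocol_step_alice he h3]
        exact ih.alice he h3

theorem length_bellProtocol_transcript {x y : QubitMeasurement} {ω : Fin 2 × ℝ} {n : ℕ}
    (h : ¬ Ended (bellProtocol.transcript x y ω n)) :
    (bellProtocol.transcript x y ω n).length = n := by
  induction n with
  | zero => rfl
  | succ n ih =>
    rw [bellProtocol_transcript_succ] at h ⊢
    by_cases he : Ended (bellProtocol.transcript x y ω n)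
    · rw [bellProtocol_step_of_ended he] at h
      exact absurd he h
    · rw [length_bellProtocol_step he, ih he]

-- Termination and expected cost

/-- Where the protocol may still be running after `n` bits. -/
def undecided (x y : QubitMeasurement) (n : ℕ) : Set (Fin 2 × ℝ) :=
  {ω | 4 ≤ n → |ω.2 - condProb x y ω.1| ≤ 3 * (1 / 2) ^ (n / 4)}

theorem mem_undecided {x y : QubitMeasurement} {ω : Fin 2 × ℝ} {n : ℕ}
    (h : ¬ Ended (bellProtocol.transcript x y ω n)) : ω ∈ undecided x y n := by
  intro hn
  have hl := length_bellProtocol_transcript h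
  have := (reachable_transcript x y ω n).of_not_ended h (by omega)
  rwa [hl] at this

theorem exists_ended {x y : QubitMeasurement} {ω : Fin 2 × ℝ} (h : ω.2 ≠ condProb x y ω.1) :
    ∃ n, Ended (bellProtocol.transcript x y ω n) := by
  by_contra! hn
  have hpos : 0 < |ω.2 - condProb x y ω.1| / 3 := by
    have := abs_pos.2 (sub_ne_zero.2 h)
    positivity
  obtain ⟨k, hk⟩ := exists_pow_lt_of_lt_one hpos (by norm_num : (1 / 2 : ℝ) < 1)
  have := mem_undecided (hn (4 * (k + 1))) (by omega)
  rw [Nat.mul_div_cancel_left _ (by norm_num), pow_succ] at this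
  have hp : (0 : ℝ) < (1 / 2) ^ k := by positivity
  linarith

theorem measurableSet_undecided (x y : QubitMeasurement) (n : ℕ) :
    MeasurableSet (undecided x y n) := by
  by_cases hn : 4 ≤ n
  · simp only [undecided, hn, true_imp_iff]
    have hm : Measurable fun ω : Fin 2 × ℝ => condProb x y ω.1 :=
      (Measurable.of_discrete (f := condProb x y)).comp measurable_fst
    exact measurableSet_le (measurable_snd.sub hm).abs measurable_const
  · simp [undecided, hn]

theorem measure_undecided_le (x y : QubitMeasurement) (n : ℕ) :
    (x.outcomeLaw.prod unitLaw) (undecided x y n) ≤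
      ENNReal.ofReal (min 1 (6 * (1 / 2) ^ (n / 4))) := by
  by_cases hn : 4 ≤ n
  · rw [ENNReal.ofReal_min, ENNReal.ofReal_one]
    refine le_min prob_le_one ?_
    rw [Measure.prod_apply (measurableSet_undecided x y n)]
    refine (lintegral_mono (g := fun _ => ENNReal.ofReal (6 * (1 / 2) ^ (n / 4))) fun a => ?_).trans
      (by rw [lintegral_const, measure_univ, mul_one])
    have : Prod.mk a ⁻¹' undecided x y n =
        Metric.closedBall (condProb x y a) (3 * (1 / 2) ^ (n / 4)) := by
      ext r
      simp [undecided, hn, Real.dist_eq]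
    rw [this]
    -- The part of the ball outside `[0, 1]` is simply kept; its full length is twice the radius.
    refine (Measure.restrict_apply_le _ _).trans_eq ?_
    rw [Real.volume_closedBall]
    congr 1
    ring
  · have : n / 4 = 0 := by omega
    rw [this]
    norm_num
    exact prob_le_one

/-- The first three rounds count as `1` per bit, giving `12`. Each later block of four terms
contributes `3 · 2⁻ᵐ`, exactly the increment of the telescoping bound. -/
theorem sum_range_min_le (m : ℕ) :
    ∑ k ∈ Finset.range (4 * (m + 3)), min (1 : ℝ) (6 * (1 / 2) ^ (k / 4)) ≤
      18 - 6 * (1 / 2) ^ m := by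
  induction m with
  | zero =>
    refine (Finset.sum_le_sum fun k _ => min_le_left _ _).trans ?_
    norm_num
  | succ m ih =>
    have e : 4 * (m + 1 + 3) = 4 * (m + 3) + 1 + 1 + 1 + 1 := by ring
    rw [e]
    simp only [Finset.sum_range_succ]
    have hk (j : ℕ) (hj : j < 4) :
        min (1 : ℝ) (6 * (1 / 2) ^ ((4 * (m + 3) + j) / 4)) ≤ 3 / 4 * (1 / 2) ^ m := by
      have e : (4 * (m + 3) + j) / 4 = m + 3 := by omega
      rw [e]
      refine (min_le_right _ _).trans_eq ?_
      ring
    have h0 := hk 0 (by norm_num)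
    have h1 := hk 1 (by norm_num)
    have h2 := hk 2 (by norm_num)
    have h3 := hk 3 (by norm_num)
    simp only [add_zero, add_assoc, Nat.reduceAdd] at *
    have hp : (1 / 2 : ℝ) ^ (m + 1) = (1 / 2) ^ m / 2 := by ring
    rw [hp]
    linarith

/-- The length grows by one precisely at the steps where the protocol is still running. -/
theorem length_transcript_le (x y : QubitMeasurement) (ω : Fin 2 × ℝ) (n : ℕ) :
    ((bellProtocol.transcript x y ω n).length : ℝ≥0∞) ≤
      ∑ k ∈ Finset.range n, (undecided x y k).indicator 1 ω := by
  induction n with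
  | zero => simp [Protocol.transcript]
  | succ n ih =>
    rw [Finset.sum_range_succ, bellProtocol_transcript_succ]
    by_cases he : Ended (bellProtocol.transcript x y ω n)
    · rw [bellProtocol_step_of_ended he]
      exact ih.trans le_self_add
    · rw [length_bellProtocol_step he, Set.indicator_of_mem (mem_undecided he), Nat.cast_add,
        Nat.cast_one]
      exact add_le_add_left ih 1

theorem expectedCost_bellProtocol_le (x y : QubitMeasurement) :
    bellProtocol.expectedCost x y ≤ 18 := by
  have h1 : bellProtocol.expectedCost x y ≤
      ∫⁻ ω, ∑' k, (undecided x y k).indicator 1 ω ∂(x.outcomeLaw.prod unitLaw) := by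
    refine lintegral_mono fun ω => ?_
    exact iSup_le fun n => (length_transcript_le x y ω n).trans (ENNReal.sum_le_tsum _)
  refine h1.trans ?_
  rw [lintegral_tsum fun k =>
    (measurable_one.indicator (measurableSet_undecided x y k)).aemeasurable]
  simp only [lintegral_indicator_one (measurableSet_undecided x y _)]
  rw [ENNReal.tsum_eq_iSup_nat]
  refine iSup_le fun n => ?_
  calc ∑ k ∈ Finset.range n, (x.outcomeLaw.prod unitLaw) (undecided x y k)
      ≤ ∑ k ∈ Finset.range (4 * (n + 3)), (x.outcomeLaw.prod unitLaw) (undecided x y k) :=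
        Finset.sum_le_sum_of_subset (Finset.range_mono (by omega))
    _ ≤ ∑ k ∈ Finset.range (4 * (n + 3)), ENNReal.ofReal (min 1 (6 * (1 / 2) ^ (k / 4))) :=
        Finset.sum_le_sum fun k _ => measure_undecided_le x y k
    _ = ENNReal.ofReal (∑ k ∈ Finset.range (4 * (n + 3)), min 1 (6 * (1 / 2) ^ (k / 4))) :=
        (ENNReal.ofReal_sum_of_nonneg fun k _ => by positivity).symm
    _ ≤ ENNReal.ofReal 18 := by
        refine ENNReal.ofReal_le_ofReal ((sum_range_min_le n).trans ?_)
        have : (0 : ℝ) < (1 / 2) ^ n := by positivity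
        linarith
    _ = 18 := by norm_num

-- Exactness of the output distribution

/-- The protocol ends with the outputs `a` and `b` exactly on a product set. -/
theorem bellProtocol_output_iff (x y : QubitMeasurement) (ω : Fin 2 × ℝ) (a b : Fin 2) :
    (∃ n, bellProtocol.turn (bellProtocol.transcript x y ω n) = Turn.done ∧
      bellProtocol.outA x (bellProtocol.transcript x y ω n) ω.1 = a ∧
      bellProtocol.outB y (bellProtocol.transcript x y ω n) ω.2 = b) ↔
    ω ∈ ({a} : Set (Fin 2)) ×ˢ
      (if b = 0 then Set.Iio (condProb x y a) else Set.Ioi (condProb x y a)) := by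
  have hout (n) (h : Ended (bellProtocol.transcript x y ω n)) :
      bellProtocol.outB y (bellProtocol.transcript x y ω n) ω.2 = b ↔
        ω.2 ∈ (if b = 0 then Set.Iio (condProb x y ω.1) else Set.Ioi (condProb x y ω.1)) := by
    obtain ⟨h1, h2⟩ := (reachable_transcript x y ω n).of_ended h
    rw [bellProtocol_outB]
    by_cases hr : ω.2 < effectProb (y.proj 0) (centre (bellProtocol.transcript x y ω n))
    · rw [if_pos hr]
      fin_cases b <;> simp [h1 hr, (h1 hr).le]
    · rw [if_neg hr]
      fin_cases b <;> simp [h2 hr, (h2 hr).le]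
  rw [Set.mem_prod, Set.mem_singleton_iff]
  constructor
  · rintro ⟨n, hd, ha, hb⟩
    have ha' : ω.1 = a := ha
    subst ha'
    exact ⟨rfl, (hout n (bellProtocol_turn_eq_done.1 hd)).1 hb⟩
  · rintro ⟨rfl, hb⟩
    have hne : ω.2 ≠ condProb x y ω.1 := by
      intro h
      rw [h] at hb
      split_ifs at hb <;> simp at hb
    obtain ⟨n, hn⟩ := exists_ended hne
    exact ⟨n, bellProtocol_turn_eq_done.2 hn, rfl, (hout n hn).2 hb⟩

theorem unitLaw_real_Iio {p : ℝ} (h0 : 0 ≤ p) (h1 : p ≤ 1) : unitLaw.real (Set.Iio p) = p := by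
  have : Set.Iio p ∩ Set.Icc 0 1 = Set.Ico 0 p := by
    ext r
    simp only [Set.mem_inter_iff, Set.mem_Iio, Set.mem_Icc, Set.mem_Ico]
    exact ⟨fun h => ⟨h.2.1, h.1⟩, fun h => ⟨h.2, h.1, h.2.le.trans h1⟩⟩
  rw [unitLaw, measureReal_restrict_apply measurableSet_Iio, this, Real.volume_real_Ico_of_le h0,
    sub_zero]

theorem unitLaw_real_Ioi {p : ℝ} (h0 : 0 ≤ p) (h1 : p ≤ 1) :
    unitLaw.real (Set.Ioi p) = 1 - p := by
  have : Set.Ioi p ∩ Set.Icc 0 1 = Set.Ioc p 1 := by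
    ext r
    simp only [Set.mem_inter_iff, Set.mem_Ioi, Set.mem_Icc, Set.mem_Ioc]
    exact ⟨fun h => ⟨h.1, h.2.2⟩, fun h => ⟨h.1, h0.trans h.1.le, h.2⟩⟩
  rw [unitLaw, measureReal_restrict_apply measurableSet_Ioi, this, Real.volume_real_Ioc_of_le h1]

theorem outputProb_bellProtocol (x y : QubitMeasurement) (a b : Fin 2) :
    bellProtocol.outputProb x y a b = bornProb bellState x y a b := by
  have h : bellProtocol.outputProb x y a b = (x.outcomeLaw.prod unitLaw).real
      (({a} : Set (Fin 2)) ×ˢ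
        (if b = 0 then Set.Iio (condProb x y a) else Set.Ioi (condProb x y a))) :=
    congrArg (x.outcomeLaw.prod unitLaw).real
      (Set.ext fun ω => bellProtocol_output_iff x y ω a b)
  have hw : x.outcomeLaw.real {a} = x.weight a := by
    rw [Measure.real, outcomeLaw_singleton, ENNReal.toReal_ofReal (x.weight_nonneg a)]
  rw [h, measureReal_prod_prod, hw]
  -- An outcome of weight zero makes both sides vanish, so bounds on its conditional probability are
  -- not needed.
  by_cases h0 : x.weight a = 0
  · fin_cases b
    · simp [bornProb_zero, h0]
    · simp [bornProb_one, h0]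
  · obtain ⟨c0, c1⟩ := condProb_mem x y a h0
    fin_cases b
    · simp [bornProb_zero, unitLaw_real_Iio c0 c1]
    · simp [bornProb_one, unitLaw_real_Ioi c0 c1]

/-- There is a protocol without shared randomness that exactly simulates all pairs of von Neumann
measurements on the two qubits of a Bell state, and a constant below 22 that bounds the expected
number of bits sent for every pair of measurements. -/
theorem theorem1 :
    ∃ P : Protocol QubitMeasurement QubitMeasurement (Fin 2) (Fin 2), ∃ c : ℝ≥0∞, c < 22 ∧
      ∀ x y : QubitMeasurement,
        (∀ a b : Fin 2, P.outputProb x y a b = bornProb bellState x y a b) ∧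
        P.expectedCost x y ≤ c := by
  exact ⟨bellProtocol, 18, by norm_num, fun x y =>
    ⟨outputProb_bellProtocol x y, expectedCost_bellProtocol_le x y⟩⟩
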